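/- Let $F$ be a field of characteristic different from $2$ and let $A$ be an Albert algebra over $F$, that is, a (linear) Jordan $F$-algebra which is a form of the split exceptional algebra $H_3(\mathbb O)$: for some field extension $K/F$, the $K$-algebra $K\otimes_F A$ is isomorphic to the $27$-dimensional algebra $H_3(\mathbb O_K)$ of hermitian $3\times 3$ matrices over the split octonion algebra $\mathbb O_K$ of $K$, with product $X\bullet Y=\tfrac12(XY+YX)$. For $a\in A$ let $R_a\colon x\mapsto xa$ and $U_a=2R_a^2-R_{a^2}$. If $a,b\in A$ satisfy $ab=0$, then $[U_a,U_b]=U_aU_b-U_bU_a=0$. -/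

import Mathlib

universe u v

open scoped TensorProduct Matrix

/-- The split octonion algebra over `K`, in the form of Zorn vector matrices
`(a, u; v, b)` with `a, b ∈ K` and `u, v ∈ K³`. -/
@[ext]
structure SplitOctonion (K : Type*) where
  a : K
  u : Fin 3 → K
  v : Fin 3 → K
  b : K

namespace SplitOctonion

section ring
variable {K : Type*} [CommRing K]

instance : Zero (SplitOctonion K) := ⟨⟨0, 0, 0, 0⟩⟩
instance : One (SplitOctonion K) := ⟨⟨1, 0, 0, 1⟩⟩
instance : Add (SplitOctonion K) := ⟨fun x y => ⟨x.a + y.a, x.u + y.u, x.v + y.v, x.b + y.b⟩⟩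
instance : Neg (SplitOctonion K) := ⟨fun x => ⟨-x.a, -x.u, -x.v, -x.b⟩⟩
instance : SMul K (SplitOctonion K) := ⟨fun c x => ⟨c * x.a, c • x.u, c • x.v, c * x.b⟩⟩

/-- Zorn's product. -/
instance : Mul (SplitOctonion K) := ⟨fun x y =>
  ⟨x.a * y.a + x.u ⬝ᵥ y.v,
   x.a • y.u + y.b • x.u - crossProduct x.v y.v,
   y.a • x.v + x.b • y.v + crossProduct x.u y.u,
   x.b * y.b + x.v ⬝ᵥ y.u⟩⟩

/-- The canonical (octonion) conjugation. -/
instance : Star (SplitOctonion K) := ⟨fun x => ⟨x.b, -x.u, -x.v, x.a⟩⟩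

@[simp] theorem zero_a : (0 : SplitOctonion K).a = 0 := rfl
@[simp] theorem zero_u : (0 : SplitOctonion K).u = 0 := rfl
@[simp] theorem zero_v : (0 : SplitOctonion K).v = 0 := rfl
@[simp] theorem zero_b : (0 : SplitOctonion K).b = 0 := rfl
@[simp] theorem one_a : (1 : SplitOctonion K).a = 1 := rfl
@[simp] theorem one_u : (1 : SplitOctonion K).u = 0 := rfl
@[simp] theorem one_v : (1 : SplitOctonion K).v = 0 := rfl
@[simp] theorem one_b : (1 : SplitOctonion K).b = 1 := rfl
@[simp] theorem add_a (x y : SplitOctonion K) : (x + y).a = x.a + y.a := rfl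
@[simp] theorem add_u (x y : SplitOctonion K) : (x + y).u = x.u + y.u := rfl
@[simp] theorem add_v (x y : SplitOctonion K) : (x + y).v = x.v + y.v := rfl
@[simp] theorem add_b (x y : SplitOctonion K) : (x + y).b = x.b + y.b := rfl
@[simp] theorem neg_a (x : SplitOctonion K) : (-x).a = -x.a := rfl
@[simp] theorem neg_u (x : SplitOctonion K) : (-x).u = -x.u := rfl
@[simp] theorem neg_v (x : SplitOctonion K) : (-x).v = -x.v := rfl
@[simp] theorem neg_b (x : SplitOctonion K) : (-x).b = -x.b := rfl
@[simp] theorem smul_a (c : K) (x : SplitOctonion K) : (c • x).a = c * x.a := rfl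
@[simp] theorem smul_u (c : K) (x : SplitOctonion K) : (c • x).u = c • x.u := rfl
@[simp] theorem smul_v (c : K) (x : SplitOctonion K) : (c • x).v = c • x.v := rfl
@[simp] theorem smul_b (c : K) (x : SplitOctonion K) : (c • x).b = c * x.b := rfl
@[simp] theorem star_a (x : SplitOctonion K) : (star x).a = x.b := rfl
@[simp] theorem star_u (x : SplitOctonion K) : (star x).u = -x.u := rfl
@[simp] theorem star_v (x : SplitOctonion K) : (star x).v = -x.v := rfl
@[simp] theorem star_b (x : SplitOctonion K) : (star x).b = x.a := rfl
@[simp] theorem mul_a (x y : SplitOctonion K) :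
    (x * y).a = x.a * y.a + x.u ⬝ᵥ y.v := rfl
@[simp] theorem mul_u (x y : SplitOctonion K) :
    (x * y).u = x.a • y.u + y.b • x.u - crossProduct x.v y.v := rfl
@[simp] theorem mul_v (x y : SplitOctonion K) :
    (x * y).v = y.a • x.v + x.b • y.v + crossProduct x.u y.u := rfl
@[simp] theorem mul_b (x y : SplitOctonion K) :
    (x * y).b = x.b * y.b + x.v ⬝ᵥ y.u := rfl

instance : NonUnitalNonAssocRing (SplitOctonion K) where
  add_assoc x y z := by ext <;> simp [add_assoc]
  zero_add x := by ext <;> simp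
  add_zero x := by ext <;> simp
  add_comm x y := by ext <;> simp [add_comm]
  neg_add_cancel x := by ext <;> simp
  nsmul := nsmulRec
  zsmul := zsmulRec
  zero_mul x := by ext <;> simp
  mul_zero x := by ext <;> simp
  left_distrib x y z := by
    ext <;> simp [mul_add, dotProduct_add, add_smul] <;> ring
  right_distrib x y z := by
    ext <;> simp [add_mul, add_dotProduct, add_smul] <;> ring

instance : Module K (SplitOctonion K) where
  one_smul x := by ext <;> simp
  mul_smul c d x := by ext <;> simp [mul_assoc]
  smul_zero c := by ext <;> simp
  smul_add c x y := by ext <;> simp [mul_add]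
  add_smul c d x := by ext <;> simp [add_mul]
  zero_smul x := by ext <;> simp

end ring
end SplitOctonion

/-- The `K`-space `H₃(O)` of hermitian `3 × 3` matrices over the split octonions `O` of `K`. -/
def hermitianOctonionMatrices (K : Type*) [Field K] :
    Submodule K (Matrix (Fin 3) (Fin 3) (SplitOctonion K)) where
  carrier := {X | Xᴴ = X}
  zero_mem' := by
    ext i j <;> simp [Matrix.conjTranspose_apply]
  add_mem' := by
    intro X Y hX hY
    have hX' : ∀ i j, star (X j i) = X i j := fun i j => congrFun (congrFun hX i) j
    have hY' : ∀ i j, star (Y j i) = Y i j := fun i j => congrFun (congrFun hY i) j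
    refine Matrix.ext fun i j => ?_
    rw [Matrix.conjTranspose_apply, Matrix.add_apply, Matrix.add_apply, ← hX' i j, ← hY' i j]
    ext <;> simp [add_comm]
  smul_mem' := by
    intro c X hX
    have hX' : ∀ i j, star (X j i) = X i j := fun i j => congrFun (congrFun hX i) j
    refine Matrix.ext fun i j => ?_
    rw [Matrix.conjTranspose_apply, Matrix.smul_apply, Matrix.smul_apply, ← hX' i j]
    ext <;> simp

/-- A Jordan algebra `A` over a field `F` of characteristic not `2` is an *Albert algebra* if it
is a form of `H₃(O)`: over some field extension `K` of `F`, the scalar extension `K ⊗ A` is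
isomorphic, as a `K`-algebra, to the hermitian `3 × 3` matrices over the split octonions of `K`
with the Jordan product `X • Y = ½ (XY + YX)`. -/
def IsAlbertAlgebra (F : Type u) (A : Type v) [Field F] [NonUnitalNonAssocCommRing A]
    [IsCommJordan A] [Module F A] [IsScalarTower F A A] [SMulCommClass F A A] : Prop :=
  ∃ (K : Type u) (_ : Field K) (_ : Algebra F K)
    (e : (K ⊗[F] A) ≃ₗ[K] hermitianOctonionMatrices K),
    ∀ x y : K ⊗[F] A,
      (e (x * y) : Matrix (Fin 3) (Fin 3) (SplitOctonion K)) =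
        (2⁻¹ : K) • ((e x).1 * (e y).1 + (e y).1 * (e x).1)

/-- The quadratic operator `U_a = 2 R_a² - R_{a²}`, where `R_a : x ↦ x a`. -/
def jordanU (F : Type*) {A : Type*} [Field F] [NonUnitalNonAssocCommRing A]
    [Module F A] [IsScalarTower F A A] [SMulCommClass F A A] (a : A) : Module.End F A :=
  2 • (LinearMap.mulRight F a) ^ 2 - LinearMap.mulRight F (a * a)

/-!
In any Jordan algebra over a field of characteristic not `2`, linearizing the Jordan identity shows
that `a * b = 0` makes `R (a²)` commute with `R b` and makes `U_a` anticommute with `R b`; by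
symmetry `R (b²)` commutes with `R a`. Hence `U_a` commutes with `(R b)²` and
`[U_a, U_b] = [R (a²), R (b²)]`, which is `2 [R (a² b), R b]` by the linearized identity once more
(`lie_jordanU_eq_zero`). It remains to see that `R (a² b)` commutes with `R b`.

For an Albert algebra this follows from the generic cubic equation `x³ - T(x) x² + S(x) x = N(x) 1`,
where `S(x) = ½ (T(x)² - T(x²))` (`octonionMatrix_cubic`, in hermitian octonion matrices). Since
`a * b = 0`, its part of degree `(2, 1)` in `(a, b)` reads
`a² b = T(b) a² - S(a) b - T(a) T(b) a + n 1` for a scalar `n`. If `T(a) T(b) = 0`, every term on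
the right gives an operator commuting with `R b`. If `T(a) ≠ 0`, multiply the equation of `a`
by `b`: as `a³ b = 0`, it becomes `T(a) a² b = -N(a) b`, so that `a² b` is a multiple of `b`
(`sq_mul_mul_mul_comm_of_cubic`).
-/

/-! ### Jordan identities for elements with zero product -/

/-- The full linearization of the Jordan identity, in element form. -/
theorem jordan_linearized {F : Type*} {A : Type*} [Field F] [NonUnitalNonAssocCommRing A]
    [IsCommJordan A] [Module F A] (hF : (2 : F) ≠ 0) (x y z w : A) :
    x * (y * z * w) - y * z * (x * w) + (y * (z * x * w) - z * x * (y * w))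
      + (z * (x * y * w) - x * y * (z * w)) = 0 := by
  have h := DFunLike.congr_fun (two_nsmul_lie_lmul_lmul_add_add_eq_zero x y z) w
  have h' : (2 : F) • (x * (y * z * w) - y * z * (x * w) + (y * (z * x * w) - z * x * (y * w))
      + (z * (x * y * w) - x * y * (z * w))) = 0 := by
    rw [two_smul, ← two_nsmul]
    exact h
  exact (smul_eq_zero.mp h').resolve_left hF

theorem jordanU_apply {F : Type*} {A : Type*} [Field F] [NonUnitalNonAssocCommRing A]
    [Module F A] [IsScalarTower F A A] [SMulCommClass F A A] (a w : A) :
    jordanU F a w = 2 • (a * (a * w)) - a * a * w := by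
  simp [jordanU, pow_two, mul_comm]

section Jordan

variable {F : Type*} {A : Type*} [Field F] [NonUnitalNonAssocCommRing A]
    [IsCommJordan A] [Module F A] {a b : A}

theorem sq_mul_mul_of_mul_eq_zero (hF : (2 : F) ≠ 0) (hab : a * b = 0) (w : A) :
    a * a * (b * w) = b * (a * a * w) := by
  have h := jordan_linearized hF a a b w
  have hba : b * a = 0 := by rw [mul_comm, hab]
  simp only [hab, hba, zero_mul, mul_zero, sub_zero, zero_add, add_zero] at h
  exact (sub_eq_zero.mp h).symm

theorem sq_mul_mul_eq_add_of_mul_eq_zero (hF : (2 : F) ≠ 0) (hab : a * b = 0) (w : A) :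
    a * a * (b * w) = a * (a * (b * w)) + b * (a * (a * w)) := by
  have h := jordan_linearized hF a b w a
  have hba : b * a = 0 := by rw [mul_comm, hab]
  simp only [hab, hba, zero_mul, mul_zero, sub_zero, add_zero] at h
  rw [mul_comm (b * w) a, mul_comm (w * a) a, mul_comm w a, mul_comm (b * w) (a * a)] at h
  have : a * a * (b * w) - (a * (a * (b * w)) + b * (a * (a * w))) = 0 := by
    rw [← neg_eq_zero, ← h]; abel
  exact sub_eq_zero.mp this

/-- In any Jordan algebra `[R (a²), R (b²)] = -2 [R b, R (a² b)]`, so the left side vanishes along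
with the right one. -/
theorem sq_mul_sq_mul_of_sq_mul_mul_comm (hF : (2 : F) ≠ 0)
    (h : ∀ w, a * a * b * (b * w) = b * (a * a * b * w)) (w : A) :
    a * a * (b * b * w) = b * b * (a * a * w) := by
  have h1 := jordan_linearized hF (a * a) b b w
  rw [mul_comm b (a * a), h w] at h1
  simpa [sub_eq_zero] using h1

theorem cube_mul_of_mul_eq_zero (hF : (2 : F) ≠ 0) (hab : a * b = 0) :
    a * a * a * b = 0 := by
  have h := sq_mul_mul_of_mul_eq_zero hF hab a
  rw [mul_comm b a, hab, mul_zero] at h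
  rw [mul_comm, ← h]

variable [IsScalarTower F A A] [SMulCommClass F A A]

/-- If `a * b = 0` then `U_a R_b = - R_b U_a`. -/
theorem jordanU_mul_of_mul_eq_zero (hF : (2 : F) ≠ 0) (hab : a * b = 0) (w : A) :
    jordanU F a (b * w) = -(b * jordanU F a w) := by
  rw [jordanU_apply, jordanU_apply, mul_sub, ← sq_mul_mul_of_mul_eq_zero hF hab,
    sq_mul_mul_eq_add_of_mul_eq_zero hF hab, two_nsmul, two_nsmul, mul_add]
  abel

/-- If `a * b = 0`, then `[U_a, U_b] = [R (a²), R (b²)]`, and this vanishes as soon as `R (a² b)`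
commutes with `R b`. -/
theorem lie_jordanU_eq_zero (hF : (2 : F) ≠ 0) (hab : a * b = 0)
    (h : ∀ w, a * a * b * (b * w) = b * (a * a * b * w)) :
    ⁅jordanU F a, jordanU F b⁆ = 0 := by
  ext w
  have hba : b * a = 0 := by rw [mul_comm, hab]
  have h1 : jordanU F a (b * b * w) = b * b * jordanU F a w := by
    rw [jordanU_apply, jordanU_apply, sq_mul_sq_mul_of_sq_mul_mul_comm hF h,
      ← sq_mul_mul_of_mul_eq_zero hF hba w,
      ← sq_mul_mul_of_mul_eq_zero hF hba (a * w), mul_sub, two_nsmul,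
      two_nsmul, mul_add]
  rw [LieRing.of_associative_ring_bracket, LinearMap.sub_apply, Module.End.mul_apply,
    Module.End.mul_apply, jordanU_apply b w, jordanU_apply b (jordanU F a w), map_sub, map_nsmul,
    jordanU_mul_of_mul_eq_zero hF hab, jordanU_mul_of_mul_eq_zero hF hab, h1]
  simp

end Jordan

/-! ### Consequences of a generic cubic equation -/

section Cubic

variable {K V A : Type*} [Field K] [AddCommGroup V] [Module K V] [NonUnitalNonAssocCommRing A]
    {one : V} {T : V →ₗ[K] K} {φ : A →+ V} {a b : A}

/-- The part of the generic cubic equation that is quadratic in `a` and linear in `b`, in the case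
`a * b = 0`. -/
theorem two_smul_map_sq_mul_eq_of_cubic (h2 : (2 : K) ≠ 0)
    (hcubic : ∀ x, ∃ n : K, (2 : K) • φ (x * x * x) - (2 * T (φ x)) • φ (x * x)
      + (T (φ x) ^ 2 - T (φ (x * x))) • φ x = n • one)
    (hab : a * b = 0) :
    ∃ n : K, (2 : K) • φ (a * a * b) = (2 * T (φ b)) • φ (a * a)
      - (T (φ a) ^ 2 - T (φ (a * a))) • φ b - (2 * T (φ a) * T (φ b)) • φ a + n • one := by
  have hba : b * a = 0 := by rw [mul_comm, hab]
  -- The part linear in `b` is extracted as half of the equation at `a + b`, minus that at `a - b`,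
  -- minus twice that at `b`.
  obtain ⟨n₁, h₁⟩ := hcubic (a + b)
  obtain ⟨n₂, h₂⟩ := hcubic (a - b)
  obtain ⟨n₃, h₃⟩ := hcubic b
  simp only [mul_add, add_mul, mul_sub, sub_mul, hab, hba, map_add, map_sub, add_zero,
    zero_add, sub_zero, zero_sub, sub_neg_eq_add] at h₁ h₂
  refine ⟨2⁻¹ * (n₁ - n₂ - 2 * n₃), smul_right_injective V h2 ?_⟩
  have : (2 : K) • (2⁻¹ * (n₁ - n₂ - 2 * n₃)) • one = n₁ • one - n₂ • one - (2 : K) • n₃ • one := by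
    rw [smul_smul, mul_inv_cancel_left₀ h2, sub_smul, sub_smul, mul_smul]
  dsimp only
  rw [smul_add, this, ← h₁, ← h₂, ← h₃]
  module

/-- In an algebra satisfying a generic cubic equation, the hypotheses `a * b = 0` and
`[R (a²), R b] = 0` force `[R (a² b), R b] = 0`. The algebra is given through an embedding `φ` into
a vector space on which its multiplication operators `R w` act and which holds a unit element.
If the traces of `a` and `b` are both nonzero, multiplying the equation of `a` by `b` makes `a² b` a
multiple of `b`; otherwise the linearized equation makes it a combination of `a²`, `b` and `1`. -/
theorem sq_mul_mul_mul_comm_of_cubic (h2 : (2 : K) ≠ 0) (R : A → V →ₗ[K] V)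
    (hR : ∀ x w, R w (φ x) = φ (x * w)) (hone : ∀ w, R w one = φ w)
    (hinj : Function.Injective φ)
    (hcubic : ∀ x, ∃ n : K, (2 : K) • φ (x * x * x) - (2 * T (φ x)) • φ (x * x)
      + (T (φ x) ^ 2 - T (φ (x * x))) • φ x = n • one)
    (hab : a * b = 0) (hcube : a * a * a * b = 0)
    (hsq : ∀ w, a * a * (b * w) = b * (a * a * w)) (w : A) :
    a * a * b * (b * w) = b * (a * a * b * w) := by
  apply hinj
  by_cases hT : T (φ a) * T (φ b) = 0
  · obtain ⟨n, h⟩ := two_smul_map_sq_mul_eq_of_cubic h2 hcubic hab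
    rw [mul_assoc 2, hT, mul_zero, zero_smul, sub_zero] at h
    have h₁ := congrArg (R (b * w)) h
    have h₂ := congrArg (R b) (congrArg (R w) h)
    simp only [map_add, map_sub, map_smul, hR, hone] at h₁ h₂
    refine smul_right_injective V h2 ?_
    dsimp only
    rw [mul_comm b (_ * w), h₁, h₂, hsq w, mul_comm b (_ * w), mul_comm b (b * w), mul_comm b w]
  · obtain ⟨n, h⟩ := hcubic a
    have h₁ := congrArg (R b) h
    simp only [map_add, map_sub, map_smul, hR, hone, hcube, hab, map_zero, smul_zero, zero_sub,
      add_zero] at h₁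
    have hTa : 2 * T (φ a) ≠ 0 := mul_ne_zero h2 (left_ne_zero_of_mul hT)
    have h₂ : φ (a * a * b) = (-(n / (2 * T (φ a)))) • φ b := by
      refine smul_right_injective V hTa ?_
      dsimp only
      rw [smul_smul, mul_neg, mul_div_cancel₀ _ hTa, neg_smul, ← h₁, neg_neg]
    have h₃ := congrArg (R (b * w)) h₂
    have h₄ := congrArg (R b) (congrArg (R w) h₂)
    simp only [map_smul, hR] at h₃ h₄
    rw [mul_comm b (_ * w), h₃, h₄, mul_comm b (b * w)]

end Cubic

/-! ### The cubic equation in hermitian octonion matrices -/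

namespace SplitOctonion
variable {K : Type*} [CommRing K]

instance : IsScalarTower K (SplitOctonion K) (SplitOctonion K) :=
  ⟨fun c x y => by ext <;> simp <;> ring⟩

instance : SMulCommClass K (SplitOctonion K) (SplitOctonion K) :=
  ⟨fun c x y => by ext <;> simp <;> ring⟩

/-- The octonion trace: `x + star x = x.trace • 1`. -/
def trace (x : SplitOctonion K) : K := x.a + x.b

/-- The octonion norm, the determinant of a Zorn vector matrix: `x * star x = x.norm • 1`. -/
def norm (x : SplitOctonion K) : K := x.a * x.b - x.u ⬝ᵥ x.v

protected theorem one_mul (x : SplitOctonion K) : 1 * x = x := by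
  ext <;> simp

protected theorem mul_one (x : SplitOctonion K) : x * 1 = x := by
  ext <;> simp

protected theorem star_star (x : SplitOctonion K) : star (star x) = x := by
  ext <;> simp

protected theorem star_one : star (1 : SplitOctonion K) = 1 := by
  ext <;> simp

protected theorem star_add (x y : SplitOctonion K) : star (x + y) = star x + star y := by
  ext <;> simp [add_comm]

protected theorem star_smul (c : K) (x : SplitOctonion K) : star (c • x) = c • star x := by
  ext <;> simp

protected theorem star_mul (x y : SplitOctonion K) : star (x * y) = star y * star x := by
  ext k <;> (try fin_cases k) <;> simp [cross_apply, dotProduct, Fin.sum_univ_three, Matrix.vecHead,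
      Matrix.vecTail] <;> ring

theorem norm_star (x : SplitOctonion K) : (star x).norm = x.norm := by
  simp [norm, mul_comm]

theorem mul_star (x : SplitOctonion K) : x * star x = x.norm • 1 := by
  ext k <;> (try fin_cases k) <;>
    simp [cross_apply, dotProduct, Fin.sum_univ_three, norm] <;> ring

theorem star_mul_self (x : SplitOctonion K) : star x * x = x.norm • 1 := by
  rw [← norm_star, ← mul_star, SplitOctonion.star_star]

theorem mul_star_mul (x y : SplitOctonion K) : x * (star x * y) = x.norm • y := by
  ext k <;> (try fin_cases k) <;>
    simp [cross_apply, dotProduct, Fin.sum_univ_three, Matrix.vecHead, Matrix.vecTail, norm] <;>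
    ring

theorem star_mul_mul (x y : SplitOctonion K) : star x * (x * y) = x.norm • y := by
  rw [← norm_star, ← mul_star_mul, SplitOctonion.star_star]

theorem mul_mul_star (x y : SplitOctonion K) : y * x * star x = x.norm • y := by
  ext k <;> (try fin_cases k) <;>
    simp [cross_apply, dotProduct, Fin.sum_univ_three, Matrix.vecHead, Matrix.vecTail, norm] <;>
    ring

theorem mul_star_mul_self (x y : SplitOctonion K) : y * star x * x = x.norm • y := by
  rw [← norm_star, ← mul_mul_star, SplitOctonion.star_star]

theorem add_star (x : SplitOctonion K) : x + star x = x.trace • 1 := by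
  ext k <;> simp [trace, add_comm]

theorem trace_star (x : SplitOctonion K) : (star x).trace = x.trace := by
  simp [trace, add_comm]

theorem trace_mul_comm (x y : SplitOctonion K) : (x * y).trace = (y * x).trace := by
  simp [trace, dotProduct, Fin.sum_univ_three]; ring

theorem trace_mul_assoc (x y z : SplitOctonion K) : (x * y * z).trace = (x * (y * z)).trace := by
  simp [trace, cross_apply, dotProduct, Fin.sum_univ_three]; ring

end SplitOctonion

/-- The sum of the diagonal entries, read off in the first scalar slot of each Zorn matrix; on a
hermitian matrix the diagonal entries are scalars and this is the generic trace. -/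
def octonionTrace (K : Type*) [Field K] :
    Matrix (Fin 3) (Fin 3) (SplitOctonion K) →ₗ[K] K where
  toFun X := (X 0 0).a + (X 1 1).a + (X 2 2).a
  map_add' X Y := by simp only [Matrix.add_apply, SplitOctonion.add_a]; ring
  map_smul' c X := by
    simp only [Matrix.smul_apply, SplitOctonion.smul_a, RingHom.id_apply, smul_eq_mul]; ring

theorem SplitOctonion.exists_eq_of_star_eq {K : Type*} [Field K] (h2 : (2 : K) ≠ 0)
    {x : SplitOctonion K} (hx : star x = x) : ∃ α : K, x = α • 1 := by
  have self_neg {v : Fin 3 → K} (h : -v = v) : v = 0 := by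
    funext k
    have hk : -v k = v k := congrFun h k
    have : 2 * v k = 0 := by linear_combination -hk
    simpa [h2] using this
  refine ⟨x.a, SplitOctonion.ext ?_ ?_ ?_ ?_⟩
  · simp
  · simpa using self_neg (congrArg SplitOctonion.u hx)
  · simpa using self_neg (congrArg SplitOctonion.v hx)
  · simpa using congrArg SplitOctonion.a hx

theorem exists_eq_of_mem_hermitianOctonionMatrices {K : Type*} [Field K] (h2 : (2 : K) ≠ 0)
    {X : Matrix (Fin 3) (Fin 3) (SplitOctonion K)} (hX : X ∈ hermitianOctonionMatrices K) :
    ∃ (α β γ : K) (c d e : SplitOctonion K),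
      X = !![α • 1, c, d; star c, β • 1, e; star d, star e, γ • 1] := by
  have hX' : ∀ i j, star (X j i) = X i j := fun i j => congrFun (congrFun hX i) j
  obtain ⟨α, hα⟩ := SplitOctonion.exists_eq_of_star_eq h2 (hX' 0 0)
  obtain ⟨β, hβ⟩ := SplitOctonion.exists_eq_of_star_eq h2 (hX' 1 1)
  obtain ⟨γ, hγ⟩ := SplitOctonion.exists_eq_of_star_eq h2 (hX' 2 2)
  refine ⟨α, β, γ, X 0 1, X 0 2, X 1 2, Matrix.ext fun i j => ?_⟩
  fin_cases i <;> fin_cases j <;> simp [hα, hβ, hγ, hX']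

/-- The generic cubic equation of hermitian octonion matrices, multiplied by `2`. -/
theorem octonionMatrix_cubic {K : Type*} [Field K] (h2 : (2 : K) ≠ 0)
    {X : Matrix (Fin 3) (Fin 3) (SplitOctonion K)} (hX : X ∈ hermitianOctonionMatrices K) :
    ∃ n : K, X * (X * X) + X * X * X - (2 * octonionTrace K X) • (X * X)
      + (octonionTrace K X ^ 2 - octonionTrace K (X * X)) • X = n • 1 := by
  obtain ⟨α, β, γ, c, d, e, rfl⟩ := exists_eq_of_mem_hermitianOctonionMatrices h2 hX
  set X : Matrix (Fin 3) (Fin 3) (SplitOctonion K) :=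
    !![α • 1, c, d; star c, β • 1, e; star d, star e, γ • 1] with hXdef
  have hsq : X * X =
      !![(α ^ 2 + c.norm + d.norm) • 1, (α + β) • c + d * star e, (α + γ) • d + c * e;
        (α + β) • star c + e * star d, (β ^ 2 + c.norm + e.norm) • 1, (β + γ) • e + star c * d;
        (α + γ) • star d + star e * star c, (β + γ) • star e + star d * c,
          (γ ^ 2 + d.norm + e.norm) • 1] := by
    refine Matrix.ext fun i j => ?_
    fin_cases i <;> fin_cases j <;>
      simp [hXdef, Matrix.mul_apply, Fin.sum_univ_three, smul_mul_assoc, mul_smul_comm,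
        SplitOctonion.one_mul, SplitOctonion.mul_one, SplitOctonion.mul_star,
        SplitOctonion.star_mul_self] <;> module
  have ht : octonionTrace K X = α + β + γ := by simp [hXdef, octonionTrace]
  have ht2 : octonionTrace K (X * X) =
      α ^ 2 + β ^ 2 + γ ^ 2 + 2 * (c.norm + d.norm + e.norm) := by
    rw [hsq]; simp [octonionTrace]; ring
  -- Two octonion products that are conjugate to each other add up to the trace of either.
  have pair (x y z : SplitOctonion K) :
      star z * star y * star x = (x * y * z).trace • 1 - x * (y * z) := by
    rw [SplitOctonion.trace_mul_assoc, ← SplitOctonion.add_star, SplitOctonion.star_mul,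
      SplitOctonion.star_mul]
    abel
  have pair' (x y z : SplitOctonion K) :
      star z * (star y * star x) = (x * y * z).trace • 1 - x * y * z := by
    rw [← SplitOctonion.add_star, SplitOctonion.star_mul, SplitOctonion.star_mul]
    abel
  -- Six products of `c`, `e` and `star d` occur on the diagonal of the cube, in conjugate pairs;
  -- all of them have the same trace.
  have h1 := pair c e (star d)
  have h1' := pair' c e (star d)
  have h2 := pair (star c) d (star e)
  have h2' := pair' (star c) d (star e)
  have h3 := pair (star d) c e
  have h3' := pair' (star d) c e
  have t3 : (star d * c * e).trace = (c * e * star d).trace := by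
    rw [SplitOctonion.trace_mul_assoc, SplitOctonion.trace_mul_comm]
  have t2 : (star c * d * star e).trace = (c * e * star d).trace := by
    rw [← SplitOctonion.trace_star, SplitOctonion.star_mul, SplitOctonion.star_mul,
      SplitOctonion.star_star, SplitOctonion.star_star, ← SplitOctonion.trace_mul_assoc,
      SplitOctonion.trace_mul_comm, SplitOctonion.trace_mul_assoc]
  rw [t2] at h2 h2'
  rw [t3] at h3 h3'
  simp only [SplitOctonion.star_star] at h1 h1' h2 h2' h3 h3'
  refine ⟨2 * (α * β * γ - α * e.norm - β * d.norm - γ * c.norm + (c * e * star d).trace),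
    Matrix.ext fun i j => ?_⟩
  rw [ht, ht2, hsq]
  fin_cases i <;> fin_cases j <;>
    simp [hXdef, smul_mul_assoc, mul_smul_comm, SplitOctonion.one_mul,
      SplitOctonion.mul_one, SplitOctonion.mul_star, mul_add, add_mul,
      SplitOctonion.star_mul_self, SplitOctonion.mul_star_mul, SplitOctonion.star_mul_mul,
      SplitOctonion.mul_mul_star, SplitOctonion.mul_star_mul_self, h1, h1', h2, h2', h3, h3']
    <;> module

/-! ### Albert algebras -/

/-- The operator `X ↦ ½ (XY + YX)` of Jordan multiplication by the matrix `Y`. -/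
noncomputable def octonionJordanMul {K : Type*} [Field K]
    (Y : Matrix (Fin 3) (Fin 3) (SplitOctonion K)) :
    Matrix (Fin 3) (Fin 3) (SplitOctonion K) →ₗ[K] Matrix (Fin 3) (Fin 3) (SplitOctonion K) :=
  (2⁻¹ : K) • (LinearMap.mulRight K Y + LinearMap.mulLeft K Y)

theorem octonionJordanMul_apply {K : Type*} [Field K]
    (X Y : Matrix (Fin 3) (Fin 3) (SplitOctonion K)) :
    octonionJordanMul Y X = (2⁻¹ : K) • (X * Y + Y * X) := rfl

theorem octonionJordanMul_one {K : Type*} [Field K] (h2 : (2 : K) ≠ 0)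
    (Y : Matrix (Fin 3) (Fin 3) (SplitOctonion K)) :
    octonionJordanMul Y 1 = Y := by
  have h₁ : (1 : Matrix (Fin 3) (Fin 3) (SplitOctonion K)) * Y = Y := by
    refine Matrix.ext fun i j => ?_
    rw [Matrix.mul_apply, Finset.sum_eq_single i] <;>
      simp +contextual [SplitOctonion.one_mul, eq_comm]
  have h₂ : Y * (1 : Matrix (Fin 3) (Fin 3) (SplitOctonion K)) = Y := by
    refine Matrix.ext fun i j => ?_
    rw [Matrix.mul_apply, Finset.sum_eq_single j] <;>
      simp +contextual [SplitOctonion.mul_one]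
  rw [octonionJordanMul_apply, h₁, h₂, ← two_smul K, smul_smul, inv_mul_cancel₀ h2, one_smul]

/-- An Albert algebra embeds into the octonion matrices over a field extension, with its product
turned into the Jordan product. -/
theorem IsAlbertAlgebra.exists_embedding {F : Type u} {A : Type v} [Field F]
    [NonUnitalNonAssocCommRing A] [IsCommJordan A] [Module F A] [IsScalarTower F A A]
    [SMulCommClass F A A] (hF : (2 : F) ≠ 0) (hA : IsAlbertAlgebra F A) :
    ∃ (K : Type u) (_ : Field K) (φ : A →+ Matrix (Fin 3) (Fin 3) (SplitOctonion K)),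
      (2 : K) ≠ 0 ∧ Function.Injective φ ∧ (∀ x, φ x ∈ hermitianOctonionMatrices K) ∧
        ∀ x y, octonionJordanMul (φ y) (φ x) = φ (x * y) := by
  obtain ⟨K, _, _, e, he⟩ := hA
  have h2 : (2 : K) ≠ 0 := by
    have := (map_ne_zero (algebraMap F K)).mpr hF
    rwa [map_ofNat] at this
  have hι : Function.Injective (TensorProduct.mk F K A 1) :=
    Module.FaithfullyFlat.tensorProduct_mk_injective (B := K) A
  let φ : A →+ Matrix (Fin 3) (Fin 3) (SplitOctonion K) := AddMonoidHom.mk'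
    (fun x => (e (1 ⊗ₜ[F] x)).1) fun x y => by
      rw [TensorProduct.tmul_add, map_add, Submodule.coe_add]
  have hφ (x : A) : φ x = (e (1 ⊗ₜ[F] x)).1 := rfl
  refine ⟨K, inferInstance, φ, h2, fun x y hxy => ?_, fun x => ?_, fun x y => ?_⟩
  · rw [hφ, hφ] at hxy
    exact hι (e.injective (Subtype.ext hxy))
  · rw [hφ]
    exact (e (1 ⊗ₜ[F] x)).2
  · rw [octonionJordanMul_apply, hφ, hφ, hφ, ← he, Algebra.TensorProduct.tmul_mul_tmul, one_mul]

theorem mainTheorem3 {F : Type u} {A : Type v} [Field F] [NonUnitalNonAssocCommRing A]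
    [IsCommJordan A] [Module F A] [IsScalarTower F A A] [SMulCommClass F A A]
    (hF : (2 : F) ≠ 0) (hA : IsAlbertAlgebra F A) (a b : A) (hab : a * b = 0) :
    ⁅jordanU F a, jordanU F b⁆ = 0 := by
  obtain ⟨K, _, φ, h2, hinj, hmem, hφ⟩ := hA.exists_embedding hF
  have hsq (x : A) : φ (x * x) = φ x * φ x := by
    rw [← hφ, octonionJordanMul_apply, ← two_smul K, smul_smul, inv_mul_cancel₀ h2, one_smul]
  refine lie_jordanU_eq_zero hF hab <| sq_mul_mul_mul_comm_of_cubic (T := octonionTrace K) h2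
    (fun w => octonionJordanMul (φ w)) hφ (fun w => octonionJordanMul_one h2 (φ w)) hinj
    (fun x => ?_) hab (cube_mul_of_mul_eq_zero hF hab) (sq_mul_mul_of_mul_eq_zero hF hab)
  obtain ⟨n, hn⟩ := octonionMatrix_cubic h2 (hmem x)
  refine ⟨n, ?_⟩
  rw [← hφ (x * x) x, octonionJordanMul_apply, smul_smul, mul_inv_cancel₀ h2, one_smul, hsq,
    add_comm (φ x * φ x * φ x)]
  exact hn
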